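/- A 3-graph is a 3-uniform hypergraph. For a 3-graph $H$ with at least one edge, let $\delta_2^+(H)$ be the maximum $k$ such that every pair of vertices contained in an edge of $H$ is contained in at least $k$ edges of $H$; for a 3-graph $H$ without edges put $\delta_2^+(H)=0$. Let $K_4^-$ be the 3-graph on $\{1,2,3,4\}$ with edges $123,124,134$. A 3-graph is $K_4^-$-free if it has no (not necessarily induced) subhypergraph isomorphic to $K_4^-$. Let $\mathrm{co^+ex}(n,K_4^-)$ be the maximum of $\delta_2^+(H)$ over all $K_4^-$-free 3-graphs $H$ on $n$ vertices; an $n$-vertex $K_4^-$-free 3-graph $H$ is extremal if $\delta_2^+(H)=\mathrm{co^+ex}(n,K_4^-)$. Call a partition of the vertex set balanced if the class sizes differ by at most one. The complete balanced 3-partite 3-graph on $n$ vertices has as edges all triples with one vertex in each of the three classes $V_1,V_2,V_3$ of a balanced partition. Let $H_6$ be the $(6,3,2)$-design on $\{1,\dots,6\}$ with edges $123,124,345,346,561,562,135,146,236,245$. The balanced blow-up of $H_6$ on $n$ vertices, for $6 \mid n$, has as edges all triples with one vertex in each of $V_i,V_j,V_k$ for some edge $ijk$ of $H_6$, where $V_1\cup\dots\cup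 V_6$ is a partition of the vertex set into classes of size $n/6$. **Theorem.** For every integer $n\ge 0$, $$\mathrm{co^+ex}(n,K_4^-)=\lfloor n/3\rfloor .$$ Moreover, if $n\ge 1$ and $n\equiv 0 \pmod 6$, then up to isomorphism there are exactly two extremal 3-graphs on $n$ vertices: the complete balanced 3-partite 3-graph and the balanced blow-up of $H_6$ (both are extremal, they are not isomorphic, and every extremal 3-graph is isomorphic to one of them). If $n\equiv 3\pmod 6$, then up to isomorphism the complete balanced 3-partite 3-graph is the unique extremal 3-graph on $n$ vertices. -/

import Mathlib

/-- A `3`-graph (3-uniform hypergraph) on the vertex set `V`. -/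
structure ThreeGraph (V : Type*) where
  edges : Finset (Finset V)
  uniform : ∀ e ∈ edges, e.card = 3

namespace ThreeGraph

/-- The co-degree of a set `S`: the number of edges that contain `S`. -/
def codegree {V : Type*} [DecidableEq V] (H : ThreeGraph V) (S : Finset V) : ℕ :=
  (H.edges.filter (fun e => S ⊆ e)).card

/-- The numbers `k` such that every pair of vertices contained in an edge of `H` is contained in
at least `k` edges of `H`. -/
def codegreeBounds {V : Type*} [DecidableEq V] (H : ThreeGraph V) : Set ℕ :=
  {k | ∀ S : Finset V, S.card = 2 → (∃ e ∈ H.edges, S ⊆ e) → k ≤ H.codegree S}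

open Classical in
/-- The minimum positive co-degree `δ₂⁺(H)`: for a 3-graph with at least one edge, the maximum `k`
such that every pair contained in an edge is contained in at least `k` edges (see
`isGreatest_minPosCodegree`); by convention it is `0` for the 3-graph without edges. -/
noncomputable def minPosCodegree {V : Type*} [DecidableEq V] (H : ThreeGraph V) : ℕ :=
  if H.edges.Nonempty then sSup H.codegreeBounds else 0

/-- `H` contains `F` as a (not necessarily induced) subhypergraph. -/
def Contains {V W : Type*} (H : ThreeGraph V) (F : ThreeGraph W) : Prop :=
  ∃ f : W ↪ V, ∀ e ∈ F.edges, e.map f ∈ H.edges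

/-- `H` is `F`-free. -/
def Free {V W : Type*} (F : ThreeGraph W) (H : ThreeGraph V) : Prop :=
  ¬ H.Contains F

/-- The positive co-degrees `δ₂⁺(H)` of the `n`-vertex `F`-free 3-graphs `H`. -/
def posCodegreeValues {W : Type*} (n : ℕ) (F : ThreeGraph W) : Set ℕ :=
  {d | ∃ H : ThreeGraph (Fin n), F.Free H ∧ H.minPosCodegree = d}

/-- The positive co-degree Turán number `co⁺ex(n, F)`: the maximum of `δ₂⁺(H)` over all `n`-vertex
`F`-free 3-graphs `H` (see `isGreatest_coex`). -/
noncomputable def coex {W : Type*} (n : ℕ) (F : ThreeGraph W) : ℕ :=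
  sSup (posCodegreeValues n F)

/-- An `n`-vertex 3-graph `H` is extremal for `F`. -/
def IsExtremal {W : Type*} {n : ℕ} (F : ThreeGraph W) (H : ThreeGraph (Fin n)) : Prop :=
  F.Free H ∧ H.minPosCodegree = coex n F

/-- Isomorphism of 3-graphs. -/
def Isomorphic {V W : Type*} (H : ThreeGraph V) (G : ThreeGraph W) : Prop :=
  ∃ f : V ≃ W, ∀ e : Finset V, e ∈ H.edges ↔ e.map f.toEmbedding ∈ G.edges

/-- The 3-graph `K₄⁻` with edges `123, 124, 134` (vertices shifted down by one). -/
def K4minus : ThreeGraph (Fin 4) where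
  edges := {{0, 1, 2}, {0, 1, 3}, {0, 2, 3}}
  uniform := by decide

/-- The `(6,3,2)`-design `H₆` with edges `123, 124, 345, 346, 561, 562, 135, 146, 236, 245`
(vertices shifted down by one). -/
def H6 : ThreeGraph (Fin 6) where
  edges := {{0, 1, 2}, {0, 1, 3}, {2, 3, 4}, {2, 3, 5}, {4, 5, 0}, {4, 5, 1},
    {0, 2, 4}, {0, 3, 5}, {1, 2, 5}, {1, 3, 4}}
  uniform := by decide

/-- The complete partite 3-graph whose classes are the fibres of `c`: its edges are the triples of
vertices that lie in three different classes. -/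
def completePartite {V K : Type*} [Fintype V] [DecidableEq K] (c : V → K) : ThreeGraph V where
  edges := (Finset.powersetCard 3 Finset.univ).filter (fun e => (e.image c).card = 3)
  uniform := fun _ he => (Finset.mem_powersetCard.mp (Finset.mem_filter.mp he).1).2

/-- The blow-up of `G` whose classes are the fibres of `c`: its edges are the triples of vertices
whose three classes form an edge of `G`. -/
def blowup {V W : Type*} [Fintype V] [DecidableEq W] (G : ThreeGraph W) (c : V → W) :
    ThreeGraph V where
  edges := (Finset.powersetCard 3 Finset.univ).filter (fun e => e.image c ∈ G.edges)
  uniform := fun _ he => (Finset.mem_powersetCard.mp (Finset.mem_filter.mp he).1).2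

/-- The partition given by the fibres of `c` is balanced: class sizes differ by at most one. -/
def IsBalanced {V K : Type*} [Fintype V] [DecidableEq K] (c : V → K) : Prop :=
  ∀ i j : K, (Finset.univ.filter (fun v => c v = i)).card ≤
    (Finset.univ.filter (fun v => c v = j)).card + 1

/-- The partition of `n` vertices into `k` classes by residues modulo `k`. It is balanced (see
`isBalanced_residueClass`), and every balanced partition into `k` classes arises from it by
permuting the vertices and renaming the classes. -/
def residueClass (n k : ℕ) [NeZero k] (v : Fin n) : Fin k :=
  ⟨v.val % k, Nat.mod_lt _ (NeZero.pos k)⟩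

/-- The complete balanced 3-partite 3-graph on `n` vertices. -/
def balancedTripartite (n : ℕ) : ThreeGraph (Fin n) :=
  completePartite (residueClass n 3)

/-- The balanced blow-up of `H₆` on `n` vertices. -/
def balancedBlowupH6 (n : ℕ) : ThreeGraph (Fin n) :=
  H6.blowup (residueClass n 6)

theorem isBalanced_residueClass (n k : ℕ) [NeZero k] : IsBalanced (residueClass n k) := by
  have hk : 0 < k := NeZero.pos k
  have key : ∀ i : Fin k, (Finset.univ.filter (fun v => residueClass n k v = i)).card =
      Nat.count (· ≡ i.val [MOD k]) n := by
    intro i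
    rw [Nat.count_eq_card_filter_range]
    refine Finset.card_bij (fun v _ => v.val) ?_ (fun _ _ _ _ h => Fin.ext h) ?_
    · intro v hv
      have h := congrArg Fin.val (Finset.mem_filter.mp hv).2
      simp only [residueClass] at h
      simp [Nat.ModEq, h, Nat.mod_eq_of_lt i.isLt]
    · intro m hm
      simp only [Finset.mem_filter, Finset.mem_range, Nat.ModEq, Nat.mod_eq_of_lt i.isLt] at hm
      exact ⟨⟨m, hm.1⟩, Finset.mem_filter.mpr ⟨Finset.mem_univ _, Fin.ext hm.2⟩, rfl⟩
  intro i j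
  rw [key, key, Nat.count_modEq_card _ hk, Nat.count_modEq_card _ hk]
  split_ifs <;> omega

theorem isGreatest_minPosCodegree {V : Type*} [DecidableEq V] (H : ThreeGraph V)
    (h : H.edges.Nonempty) : IsGreatest H.codegreeBounds H.minPosCodegree := by
  obtain ⟨e, he⟩ := h
  obtain ⟨S, hS, hc⟩ := Finset.exists_subset_card_eq (s := e) (n := 2)
    (by rw [H.uniform e he]; norm_num)
  rw [minPosCodegree, if_pos ⟨e, he⟩]
  have hb : BddAbove H.codegreeBounds := ⟨H.codegree S, fun k hk => hk S hc ⟨e, he, hS⟩⟩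
  exact ⟨Nat.sSup_mem ⟨0, fun _ _ _ => Nat.zero_le _⟩ hb, fun k hk => le_csSup hb hk⟩

theorem isGreatest_coex {W : Type*} (n : ℕ) (F : ThreeGraph W) (hF : F.edges.Nonempty) :
    IsGreatest (posCodegreeValues n F) (coex n F) := by
  have hfin : (posCodegreeValues n F).Finite := by
    have : Finite (ThreeGraph (Fin n)) :=
      Finite.of_injective (fun H => H.edges) (by rintro ⟨a, _⟩ ⟨b, _⟩ h; cases h; rfl)
    refine (Set.finite_range (fun H : ThreeGraph (Fin n) => H.minPosCodegree)).subset ?_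
    rintro d ⟨H, _, rfl⟩
    exact ⟨H, rfl⟩
  have hne : (posCodegreeValues n F).Nonempty := by
    obtain ⟨e, he⟩ := hF
    refine ⟨_, ⟨∅, by simp⟩, ?_, rfl⟩
    rintro ⟨f, hf⟩
    simpa using hf e he
  exact ⟨Nat.sSup_mem hne hfin.bddAbove, fun k hk => le_csSup hfin.bddAbove hk⟩

end ThreeGraph

/-!
Let `H` be a `K₄⁻`-free 3-graph with an edge `abc` and positive co-degree `k`. The three sets of
common neighbours of `ab`, `bc` and `ac` are disjoint, as a common element would span a `K₄⁻` with
the edge (`card_coneighbors_union`); hence `3 * k ≤ n`. The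
balanced complete tripartite 3-graph attains `k = ⌊n / 3⌋`.

If `n = 3 * k`, these three sets have size exactly `k` and cover all vertices
(`isDominating_of_card`). So four vertices span either no edge or exactly two, and consequently `H`
is determined by the link graph of any vertex `x`: a triple is an edge of `H` precisely when it
spans an odd number of edges of the link (`triple_mem_iff_link`). The link has no triangle, no two
disjoint edges without an edge between them, and all its non-isolated vertices have degree `k`.

Take `x` in an edge `xab`. If all vertices outside the neighbourhoods of `a` and `b` in the link are
isolated, regularity makes the link complete bipartite, and the parity rule turns `H` into a
complete tripartite 3-graph (`exists_eq_blowup_singleEdge`). Otherwise the link contains a 5-cycle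
(`isolated_or_pentagon`), which forces it to be a blow-up of the 5-cycle together with isolated
vertices. The link of a vertex of `H₆` is a 5-cycle, so the parity rule turns `H` into a blow-up of
`H₆` (`exists_eq_blowup_H6`). The degree conditions on the 5-cycle make all six classes equal, of
size `k / 2`, which requires `k` to be even.

Both constructions are handled as blow-ups, and a 3-graph is isomorphic to a blow-up exactly when it
is itself a blow-up with the same class sizes (`isomorphic_blowup_iff`).
-/

namespace ThreeGraph

/-! ### Edges as triples -/

section Triples

variable {V : Type*} [DecidableEq V] {H H' : ThreeGraph V}

theorem triple_mem_swap_left {a b c : V} (h : {a, b, c} ∈ H.edges) : {b, a, c} ∈ H.edges := by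
  rwa [Finset.insert_comm]

theorem triple_mem_swap_right {a b c : V} (h : {a, b, c} ∈ H.edges) : {a, c, b} ∈ H.edges := by
  rwa [Finset.pair_comm]

theorem triple_mem_rotate {a b c : V} (h : {a, b, c} ∈ H.edges) : {b, c, a} ∈ H.edges :=
  triple_mem_swap_right (triple_mem_swap_left h)

theorem ne_of_triple_mem {a b c : V} (h : {a, b, c} ∈ H.edges) : a ≠ b ∧ a ≠ c ∧ b ≠ c := by
  have h3 := H.uniform _ h
  refine ⟨?_, ?_, ?_⟩ <;> rintro rfl <;>
    simp only [Finset.mem_insert, Finset.mem_singleton, true_or, or_true, Finset.insert_eq_of_mem]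
      at h3 <;>
    exact absurd (h3.symm.trans_le Finset.card_le_two) (by decide)

theorem ext_triples (h : ∀ a b c : V, {a, b, c} ∈ H.edges ↔ {a, b, c} ∈ H'.edges) : H = H' := by
  have : H.edges = H'.edges := by
    ext e
    constructor <;> intro he
    · obtain ⟨a, b, c, -, -, -, rfl⟩ := Finset.card_eq_three.mp (H.uniform e he)
      exact (h a b c).1 he
    · obtain ⟨a, b, c, -, -, -, rfl⟩ := Finset.card_eq_three.mp (H'.uniform e he)
      exact (h a b c).2 he
  cases H; cases H'; cases this; rfl

theorem free_K4minus_iff : K4minus.Free H ↔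
    ∀ a b c d : V, {a, b, c} ∈ H.edges → {a, b, d} ∈ H.edges → {a, c, d} ∉ H.edges := by
  constructor
  · intro hF a b c d h₁ h₂ h₃
    obtain ⟨hab, hac, hbc⟩ := ne_of_triple_mem h₁
    obtain ⟨-, had, hbd⟩ := ne_of_triple_mem h₂
    obtain ⟨-, -, hcd⟩ := ne_of_triple_mem h₃
    have hinj : Function.Injective ![a, b, c, d] := by
      intro i j hij
      fin_cases i <;> fin_cases j <;> simp_all
    refine hF ⟨⟨_, hinj⟩, ?_⟩
    intro e he
    simp only [K4minus, Finset.mem_insert, Finset.mem_singleton] at he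
    rcases he with rfl | rfl | rfl <;> simpa [Finset.map_insert]
  · rintro h ⟨f, hf⟩
    have h₁ := hf {0, 1, 2} (by decide)
    have h₂ := hf {0, 1, 3} (by decide)
    have h₃ := hf {0, 2, 3} (by decide)
    simp only [Finset.map_insert, Finset.map_singleton] at h₁ h₂ h₃
    exact h _ _ _ _ h₁ h₂ h₃

variable [Fintype V]

/-- The third vertices of the edges through `a` and `b`. -/
def coneighbors (H : ThreeGraph V) (a b : V) : Finset V :=
  Finset.univ.filter fun v => {a, b, v} ∈ H.edges

theorem mem_coneighbors {a b v : V} : v ∈ H.coneighbors a b ↔ {a, b, v} ∈ H.edges := by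
  simp [coneighbors]

theorem codegree_pair {a b : V} (hab : a ≠ b) : H.codegree {a, b} = (H.coneighbors a b).card := by
  have himg : H.edges.filter (fun e => {a, b} ⊆ e) =
      (H.coneighbors a b).image fun v => ({a, b, v} : Finset V) := by
    ext e
    simp only [Finset.mem_filter, Finset.mem_image, mem_coneighbors]
    constructor
    · rintro ⟨he, hs⟩
      obtain ⟨v, hv⟩ := Finset.card_eq_one.mp (show (e \ {a, b}).card = 1 by
        rw [Finset.card_sdiff_of_subset hs, H.uniform e he, Finset.card_pair hab])
      have : e = {a, b, v} := by
        rw [← Finset.sdiff_union_of_subset hs, hv]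
        ext w; simp; tauto
      exact ⟨v, this ▸ he, this.symm⟩
    · rintro ⟨v, hv, rfl⟩
      exact ⟨hv, by intro w; simp; tauto⟩
  rw [codegree, himg, Finset.card_image_of_injOn]
  intro v hv w hw hvw
  simp only [Finset.mem_coe, mem_coneighbors] at hv hw
  obtain ⟨-, hav, hbv⟩ := ne_of_triple_mem hv
  have : v ∈ ({a, b, w} : Finset V) := by
    have hm : v ∈ ({a, b, v} : Finset V) := by simp
    rwa [show ({a, b, v} : Finset V) = {a, b, w} from hvw] at hm
  simp only [Finset.mem_insert, Finset.mem_singleton] at this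
  rcases this with h | h | h
  exacts [absurd h.symm hav, absurd h.symm hbv, h]

theorem le_minPosCodegree_iff (hne : H.edges.Nonempty) {k : ℕ} : k ≤ H.minPosCodegree ↔
    ∀ a b c : V, {a, b, c} ∈ H.edges → k ≤ (H.coneighbors a b).card := by
  have hg := isGreatest_minPosCodegree H hne
  constructor
  · intro hk a b c h
    have hab := (ne_of_triple_mem h).1
    rw [← codegree_pair hab]
    exact hk.trans (hg.1 _ (Finset.card_pair hab) ⟨_, h, by intro w; simp; tauto⟩)
  · intro h
    refine hg.2 ?_
    rintro S hS ⟨e, he, hSe⟩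
    obtain ⟨a, b, hab, rfl⟩ := Finset.card_eq_two.mp hS
    obtain ⟨v, hv⟩ : (H.coneighbors a b).Nonempty := by
      rw [← Finset.card_pos, ← codegree_pair hab]
      exact Finset.card_pos.mpr ⟨e, Finset.mem_filter.mpr ⟨he, hSe⟩⟩
    rw [codegree_pair hab]
    exact h a b v (mem_coneighbors.1 hv)

/-! ### The upper bound -/

/-- The co-neighbourhoods of the three pairs of an edge of a `K₄⁻`-free 3-graph are disjoint,
since a common element would span a `K₄⁻` with the edge. -/
theorem card_coneighbors_union (hF : K4minus.Free H) {a b c : V} (h : {a, b, c} ∈ H.edges) :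
    (H.coneighbors a b ∪ H.coneighbors b c ∪ H.coneighbors a c).card =
      (H.coneighbors a b).card + (H.coneighbors b c).card + (H.coneighbors a c).card := by
  rw [free_K4minus_iff] at hF
  rw [Finset.card_union_of_disjoint, Finset.card_union_of_disjoint]
  · rw [Finset.disjoint_left]
    intro v h₁ h₂
    rw [mem_coneighbors] at h₁ h₂
    exact hF b a c v (triple_mem_swap_left h) (triple_mem_swap_left h₁) h₂
  · rw [Finset.disjoint_left]
    intro v h₁ h₂
    rw [Finset.mem_union, mem_coneighbors, mem_coneighbors] at h₁
    rw [mem_coneighbors] at h₂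
    rcases h₁ with h₁ | h₁
    · exact hF a b c v h h₁ h₂
    · exact hF c a b v (triple_mem_rotate (triple_mem_rotate h)) (triple_mem_swap_left h₂)
        (triple_mem_swap_left h₁)

theorem minPosCodegree_le (hF : K4minus.Free H) : H.minPosCodegree ≤ Fintype.card V / 3 := by
  by_cases hne : H.edges.Nonempty
  · have hk := (le_minPosCodegree_iff hne).1 le_rfl
    obtain ⟨e, he⟩ := hne
    obtain ⟨a, b, c, -, -, -, rfl⟩ := Finset.card_eq_three.mp (H.uniform e he)
    have h₁ := hk a b c he
    have h₂ := hk b c a (triple_mem_rotate he)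
    have h₃ := hk a c b (triple_mem_swap_right he)
    have := card_coneighbors_union hF he
    have := Finset.card_le_univ (H.coneighbors a b ∪ H.coneighbors b c ∪ H.coneighbors a c)
    omega
  · simp [minPosCodegree, hne]

end Triples

/-! ### Blow-ups -/

section Blowup

variable {V W : Type*} [Fintype V] [DecidableEq W]

/-- The 3-graph on three vertices with one edge. -/
def singleEdge : ThreeGraph (Fin 3) where
  edges := {{0, 1, 2}}
  uniform := by decide

theorem completePartite_eq_blowup (c : V → Fin 3) : completePartite c = singleEdge.blowup c := by
  unfold completePartite blowup
  congr 1
  ext e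
  simp only [Finset.mem_filter, singleEdge, Finset.mem_singleton]
  have h : ∀ s : Finset (Fin 3), s.card = 3 ↔ s = {0, 1, 2} := by decide
  rw [h]

/-- The size of the class `i` of the partition into the fibres of `c`. -/
def classSize (c : V → W) (i : W) : ℕ := (Finset.univ.filter fun v => c v = i).card

theorem sum_classSize [Fintype W] (c : V → W) : ∑ i, classSize c i = Fintype.card V :=
  (Finset.card_eq_sum_card_fiberwise (fun _ _ => Finset.mem_coe.2 (Finset.mem_univ _))).symm

theorem sum_classSize_filter [Fintype W] (c : V → W) (p : W → Prop) [DecidablePred p] :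
    ∑ i with p i, classSize c i = (Finset.univ.filter fun v => p (c v)).card := by
  rw [Finset.card_eq_sum_card_fiberwise (f := c) (t := Finset.univ.filter p)]
  · refine Finset.sum_congr rfl fun i hi => ?_
    rw [classSize, Finset.filter_filter]
    congr 1
    ext v
    simp only [Finset.mem_filter, Finset.mem_univ, true_and] at hi ⊢
    constructor
    · rintro rfl; exact ⟨hi, rfl⟩
    · exact fun h => h.2
  · intro v hv
    simpa using hv

variable [DecidableEq V]

theorem mem_blowup_edges {G : ThreeGraph W} {c : V → W} {u v w : V} :
    {u, v, w} ∈ (G.blowup c).edges ↔ {c u, c v, c w} ∈ G.edges := by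
  have himg : ({u, v, w} : Finset V).image c = {c u, c v, c w} := by simp [Finset.image_insert]
  simp only [blowup, Finset.mem_filter, Finset.mem_powersetCard, Finset.subset_univ, true_and,
    himg, and_iff_right_iff_imp]
  intro h
  refine le_antisymm Finset.card_le_three ?_
  rw [← G.uniform _ h, ← himg]
  exact Finset.card_image_le

theorem free_blowup {G : ThreeGraph W} (hG : K4minus.Free G) (c : V → W) :
    K4minus.Free (G.blowup c) := by
  rw [free_K4minus_iff] at hG ⊢
  intro a b d e
  simp only [mem_blowup_edges]
  exact hG _ _ _ _

theorem card_coneighbors_blowup [Fintype W] (G : ThreeGraph W) (c : V → W) (u v : V) :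
    ((G.blowup c).coneighbors u v).card = ∑ i ∈ G.coneighbors (c u) (c v), classSize c i := by
  simp only [coneighbors, mem_blowup_edges]
  exact (sum_classSize_filter c fun i => {c u, c v, i} ∈ G.edges).symm

/-- A 3-graph is isomorphic to a blow-up exactly when it is a blow-up with the same class sizes. -/
theorem isomorphic_blowup_iff {V' : Type*} [Fintype V'] [DecidableEq V'] {H : ThreeGraph V}
    {G : ThreeGraph W} {c : V' → W} : H.Isomorphic (G.blowup c) ↔
      ∃ c' : V → W, H = G.blowup c' ∧ ∀ i, classSize c' i = classSize c i := by
  constructor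
  · rintro ⟨f, hf⟩
    refine ⟨c ∘ f, ext_triples fun u v w => ?_, fun i => ?_⟩
    · rw [hf, mem_blowup_edges]
      simp [Finset.map_insert, mem_blowup_edges]
    · refine Finset.card_equiv f fun v => ?_
      simp
  · rintro ⟨c', rfl, hc⟩
    have e : ∀ i, {v // c' v = i} ≃ {v // c v = i} := fun i =>
      Fintype.equivOfCardEq (by simpa [Fintype.card_subtype, classSize] using hc i)
    let f : V ≃ V' := (Equiv.sigmaFiberEquiv c').symm.trans
      ((Equiv.sigmaCongrRight e).trans (Equiv.sigmaFiberEquiv c))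
    have hf : ∀ v, c (f v) = c' v := fun v => (e (c' v) ⟨v, rfl⟩).2
    refine ⟨f, fun s => ?_⟩
    simp only [blowup, Finset.mem_filter, Finset.mem_powersetCard, Finset.subset_univ, true_and,
      Finset.map_eq_image, Finset.image_image]
    have : c ∘ f.toEmbedding = c' := funext hf
    rw [this, Finset.card_image_of_injective _ f.toEmbedding.injective]

end Blowup

/-! ### Links -/

section Link

variable {V : Type*} [DecidableEq V]

/-- The link graph of the vertex `x`, as a Boolean adjacency relation on all vertices. -/
def link (H : ThreeGraph V) (x y z : V) : Bool := decide ({x, y, z} ∈ H.edges)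

/-- Every vertex is a co-neighbour of some pair in each edge. For a `K₄⁻`-free 3-graph this says
that four vertices span either no edge or exactly two. -/
def IsDominating (H : ThreeGraph V) : Prop :=
  ∀ a b c v : V, {a, b, c} ∈ H.edges →
    {a, b, v} ∈ H.edges ∨ {b, c, v} ∈ H.edges ∨ {a, c, v} ∈ H.edges

variable {H : ThreeGraph V}

theorem link_eq_true {x y z : V} : H.link x y z = true ↔ {x, y, z} ∈ H.edges := by simp [link]

theorem link_comm (x y z : V) : H.link x y z = H.link x z y := by
  simp only [link, Finset.pair_comm]

theorem link_self (x y : V) : H.link x y y = false := by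
  simp only [link, decide_eq_false_iff_not]
  exact fun h => (ne_of_triple_mem h).2.2 rfl

theorem link_center (x y : V) : H.link x x y = false := by
  simp only [link, decide_eq_false_iff_not]
  exact fun h => (ne_of_triple_mem h).1 rfl

theorem link_triangle_free (hF : K4minus.Free H) {x y z w : V} (h₁ : H.link x y w = true)
    (h₂ : H.link x z w = true) : H.link x y z = false := by
  rw [link_eq_true] at h₁ h₂
  simp only [link, decide_eq_false_iff_not]
  exact fun h => free_K4minus_iff.1 hF x y z w h h₁ h₂

/-- Two edges of the link of `x` without an edge between them would span, by domination, a
complete 4-set of `H`. -/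
theorem link_not_two_disjoint_edges (hF : K4minus.Free H) (hD : H.IsDominating) {x y z p q : V}
    (hyz : H.link x y z = true) (hpq : H.link x p q = true) (hyp : H.link x y p = false)
    (hyq : H.link x y q = false) (hzp : H.link x z p = false) (hzq : H.link x z q = false) :
    False := by
  rw [link_eq_true] at hyz hpq
  simp only [link, decide_eq_false_iff_not] at hyp hyq hzp hzq
  have h₁ : {y, z, p} ∈ H.edges := by
    rcases hD x y z p hyz with h | h | h
    exacts [absurd h hyp, h, absurd h hzp]
  have h₂ : {y, z, q} ∈ H.edges := by
    rcases hD x y z q hyz with h | h | h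
    exacts [absurd h hyq, h, absurd h hzq]
  have h₃ : {p, q, y} ∈ H.edges := by
    rcases hD x p q y hpq with h | h | h
    exacts [absurd (triple_mem_swap_right h) hyp, h, absurd (triple_mem_swap_right h) hyq]
  exact free_K4minus_iff.1 hF y z p q h₁ h₂ (triple_mem_rotate (triple_mem_rotate h₃))

/-- The edges of `H` are the triples spanning an odd number of edges of the link of `x`. -/
theorem triple_mem_iff_link (hF : K4minus.Free H) (hD : H.IsDominating) (x u v w : V) :
    {u, v, w} ∈ H.edges ↔ (H.link x u v ^^ (H.link x v w ^^ H.link x u w)) = true := by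
  have hsym := fun y z => link_comm (H := H) x y z
  have one : ∀ {p q r : V}, H.link x p q = true → H.link x q r = false → H.link x p r = false →
      {p, q, r} ∈ H.edges := by
    intro p q r hpq hqr hpr
    simp only [link, decide_eq_false_iff_not] at hqr hpr
    rcases hD x p q r (link_eq_true.1 hpq) with h | h | h
    exacts [absurd h hpr, h, absurd h hqr]
  have two : ∀ {p q r : V}, H.link x p q = true → H.link x p r = true → {p, q, r} ∉ H.edges :=
    fun {p q r} hpq hpr h => free_K4minus_iff.1 hF p q r x h
      (triple_mem_rotate (link_eq_true.1 hpq)) (triple_mem_rotate (link_eq_true.1 hpr))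
  cases huv : H.link x u v <;> cases hvw : H.link x v w <;> cases huw : H.link x u w
  · refine iff_of_false (fun h => ?_) (by decide)
    simp only [link, decide_eq_false_iff_not] at huv hvw huw
    rcases hD u v w x h with h | h | h
    exacts [huv (triple_mem_rotate (triple_mem_rotate h)),
      hvw (triple_mem_rotate (triple_mem_rotate h)), huw (triple_mem_rotate (triple_mem_rotate h))]
  · exact iff_of_true (triple_mem_swap_right (one huw ((hsym _ _).trans hvw) huv)) rfl
  · exact iff_of_true (triple_mem_rotate (triple_mem_rotate
      (one hvw ((hsym _ _).trans huw) ((hsym _ _).trans huv)))) rfl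
  · exact iff_of_false (fun h => two ((hsym _ _).trans huw) ((hsym _ _).trans hvw)
      (triple_mem_rotate (triple_mem_rotate h))) (by decide)
  · exact iff_of_true (one huv hvw huw) rfl
  · exact iff_of_false (two huv huw) (by decide)
  · exact iff_of_false (fun h => two ((hsym _ _).trans huv) hvw (triple_mem_swap_left h))
      (by decide)
  · rw [link_triangle_free hF huw hvw] at huv
    exact absurd huv (by decide)

/-- If the edges of `G` are the triples spanning an odd number of edges of the link of `o`, and the
link of `x` in `H` is the pull-back along `c` of the link of `o` in `G`, then `H` is the blow-up of
`G` along `c`: both 3-graphs follow the same parity rule. -/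
theorem eq_blowup_of_link [Fintype V] {W : Type*} [DecidableEq W] {G : ThreeGraph W} {o : W}
    (hG : ∀ i j k : W, {i, j, k} ∈ G.edges ↔
      (G.link o i j ^^ (G.link o j k ^^ G.link o i k)) = true)
    (hF : K4minus.Free H) (hD : H.IsDominating) {x : V} {c : V → W}
    (hc : ∀ y z, H.link x y z = G.link o (c y) (c z)) : H = G.blowup c :=
  ext_triples fun u v w => by
    rw [triple_mem_iff_link hF hD x, mem_blowup_edges, hG, hc, hc, hc]

end Link

/-! ### Finite checks on the two models -/

theorem singleEdge_mem_iff : ∀ i j k : Fin 3, {i, j, k} ∈ singleEdge.edges ↔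
    (singleEdge.link 2 i j ^^ (singleEdge.link 2 j k ^^ singleEdge.link 2 i k)) = true := by
  decide

theorem singleEdge_free : K4minus.Free singleEdge := by
  rw [free_K4minus_iff]
  decide

set_option maxRecDepth 100000 in
theorem H6_mem_iff : ∀ i j k : Fin 6, {i, j, k} ∈ H6.edges ↔
    (H6.link 5 i j ^^ (H6.link 5 j k ^^ H6.link 5 i k)) = true := by
  decide

set_option maxRecDepth 100000 in
theorem H6_free : K4minus.Free H6 := by
  rw [free_K4minus_iff]
  have h : ∀ a b c : Fin 6, {a, b, c} ∈ H6.edges → ∀ d, {a, b, d} ∈ H6.edges →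
      {a, c, d} ∉ H6.edges := by decide
  exact fun a b c d h₁ => h a b c h₁ d

set_option maxRecDepth 100000 in
theorem H6_coneighbors_card : ∀ i j : Fin 6, i ≠ j → (H6.coneighbors i j).card = 2 := by
  decide

theorem H6_link_eq : H6.link 5 =
    ![![false, false, false, true, true, false], ![false, false, true, false, true, false],
      ![false, true, false, true, false, false], ![true, false, true, false, false, false],
      ![true, true, false, false, false, false], ![false, false, false, false, false, false]] := by
  decide

set_option maxRecDepth 100000 in
/-- The graph `H6.link 5` is the 5-cycle `0 3 2 1 4` with an isolated vertex `5`. Let `b` be an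
independent set of this 5-cycle such that, for each `i` in `b`, every edge with both ends
non-adjacent to `i` meets `b`. Then `b` is the neighbourhood of a vertex (of the isolated vertex, if
`b` is empty). -/
theorem H6_link_eq_of_independent : ∀ b : Fin 6 → Bool, b 5 = false →
    (∀ i j, H6.link 5 i j = true → b i = true → b j = false) →
    (∀ i p q, b i = true → H6.link 5 p q = true → H6.link 5 i p = false →
      H6.link 5 i q = false → b p = true ∨ b q = true) →
    ∃ j, ∀ i, b i = H6.link 5 j i := by
  decide

set_option maxRecDepth 100000 in
theorem H6_link_cases : ∀ i j : Fin 6, i ≠ 5 → j ≠ 5 →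
    (H6.link 5 i j = false ∧ ∃ k, H6.link 5 i k = true ∧ H6.link 5 j k = true) ∨
    (H6.link 5 i j = true ∧ ∃ k l, H6.link 5 i k = true ∧ H6.link 5 j l = true ∧
      H6.link 5 k l = false ∧ H6.link 5 i l = false ∧ H6.link 5 j k = false) := by
  decide

theorem H6_link_exists_disjoint_edge : ∀ j : Fin 6, ∃ p q, H6.link 5 p q = true ∧
    H6.link 5 j p = false ∧ H6.link 5 j q = false := by
  decide

/-! ### The structure of the extremal 3-graphs -/

section Structure

variable {V : Type*} [Fintype V] [DecidableEq V] {H : ThreeGraph V}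

/-- If the link of `x` contains a 5-cycle, indexed as in the link of the vertex `5` of `H₆`, then
it is a blow-up of this 5-cycle with isolated vertices. -/
theorem exists_eq_blowup_H6 (hF : K4minus.Free H) (hD : H.IsDominating) {x : V} {v : Fin 6 → V}
    (hv : ∀ i j, H.link x (v i) (v j) = H6.link 5 i j) (hx : v 5 = x) :
    ∃ c : V → Fin 6, H = H6.blowup c ∧ ∀ y i, H.link x y (v i) = H6.link 5 (c y) i := by
  have hc : ∀ y, ∃ j, ∀ i, H.link x y (v i) = H6.link 5 j i := by
    intro y
    refine H6_link_eq_of_independent (fun i => H.link x y (v i)) ?_ ?_ ?_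
    · simp only [hx]
      rw [link_comm, link_center]
    · intro i j hij hi
      by_contra hj
      rw [Bool.not_eq_false] at hj
      rw [link_comm] at hi hj
      rw [← hv, link_triangle_free hF hi hj] at hij
      exact absurd hij (by decide)
    · intro i p q hi hpq hip hiq
      by_contra! h
      simp only [ne_eq, Bool.not_eq_true] at h
      rw [← hv] at hpq hip hiq
      exact link_not_two_disjoint_edges hF hD hi hpq h.1 h.2 hip hiq
  choose c hc using hc
  have hiso : ∀ y z, c y = 5 → H.link x y z = false := by
    intro y z hy
    by_contra h
    rw [Bool.not_eq_false] at h
    obtain ⟨p, q, hpq, hp, hq⟩ := H6_link_exists_disjoint_edge (c z)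
    rw [← hc] at hp hq
    rw [← hv] at hpq
    have h5 : ∀ i, H.link x y (v i) = false := fun i => by rw [hc, hy, link_center]
    exact link_not_two_disjoint_edges hF hD h hpq (h5 p) (h5 q) hp hq
  refine ⟨c, eq_blowup_of_link H6_mem_iff hF hD (x := x) fun y z => ?_, hc⟩
  by_cases hy : c y = 5
  · rw [hiso y z hy, hy, link_center]
  by_cases hz : c z = 5
  · rw [link_comm, hiso z y hz, hz, link_comm, link_center]
  rcases H6_link_cases (c y) (c z) hy hz with ⟨h, k, hyk, hzk⟩ | ⟨h, k, l, hyk, hzl, hkl, hyl, hzk⟩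
  · rw [h]
    rw [← hc] at hyk hzk
    exact link_triangle_free hF hyk hzk
  · rw [h]
    rw [← hc] at hyk hzl hyl hzk
    rw [← hv] at hkl
    by_contra hyz
    rw [Bool.not_eq_true] at hyz
    exact link_not_two_disjoint_edges hF hD hyk hzl hyz hyl ((link_comm _ _ _).trans hzk) hkl

/-- If every vertex of the link of `x` outside the neighbourhoods of the adjacent vertices `a`
and `b` is isolated, then regularity makes the link complete bipartite. -/
theorem exists_eq_blowup_singleEdge (hF : K4minus.Free H) (hD : H.IsDominating) {k : ℕ}
    (hk : ∀ a b c : V, {a, b, c} ∈ H.edges → (H.coneighbors a b).card = k) {x a b : V}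
    (hab : H.link x a b = true)
    (hiso : ∀ w z, H.link x a w = false → H.link x b w = false → H.link x w z = false) :
    ∃ c : V → Fin 3, H = singleEdge.blowup c := by
  have hfull : ∀ y z, H.link x a y = true → H.link x b z = true → H.link x y z = true := by
    intro y z hy hz
    have hyb : {x, y, a} ∈ H.edges := link_eq_true.1 ((link_comm _ _ _).trans hy)
    have hsub : H.coneighbors x y ⊆ H.coneighbors x b := by
      intro w hw
      rw [mem_coneighbors, ← link_eq_true] at hw ⊢
      by_contra h
      rw [Bool.not_eq_true] at h
      have haw : H.link x a w = false :=
        link_triangle_free hF hy ((link_comm _ _ _).trans hw)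
      rw [link_comm, hiso w y haw h] at hw
      exact absurd hw (by decide)
    have heq := Finset.eq_of_subset_of_card_le hsub (by
      rw [hk _ _ _ hyb, hk _ _ _ (link_eq_true.1 ((link_comm _ _ _).trans hab))])
    rw [link_eq_true, ← mem_coneighbors, heq, mem_coneighbors, ← link_eq_true]
    exact hz
  refine ⟨fun y => if H.link x a y then 1 else if H.link x b y then 0 else 2,
    eq_blowup_of_link singleEdge_mem_iff hF hD (x := x) fun y z => ?_⟩
  have h00 : singleEdge.link 2 0 0 = false := by decide
  have h01 : singleEdge.link 2 0 1 = true := by decide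
  have h02 : ∀ i, singleEdge.link 2 2 i = false := by decide
  have h20 : ∀ i, singleEdge.link 2 i 2 = false := by decide
  have h10 : singleEdge.link 2 1 0 = true := by decide
  have h11 : singleEdge.link 2 1 1 = false := by decide
  have hdis : ∀ w, H.link x a w = true → H.link x b w = true → False := by
    intro w h₁ h₂
    rw [link_triangle_free hF h₁ h₂] at hab
    exact absurd hab (by decide)
  cases hay : H.link x a y <;> cases haz : H.link x a z <;> cases hby : H.link x b y <;>
    cases hbz : H.link x b z <;>
    simp only [if_true, Bool.false_eq_true, if_false, h00, h01, h02, h20, h10, h11] <;>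
    first
    | exact hiso y z hay hby
    | exact (link_comm _ _ _).trans (hiso z y haz hbz)
    | exact (hdis _ hay hby).elim
    | exact (hdis _ haz hbz).elim
    | exact hfull y z hay hbz
    | exact (link_comm _ _ _).trans (hfull z y haz hby)
    | exact link_triangle_free hF ((link_comm _ _ _).trans hay) ((link_comm _ _ _).trans haz)
    | exact link_triangle_free hF ((link_comm _ _ _).trans hby) ((link_comm _ _ _).trans hbz)

/-- Either every vertex of the link of `x` lying in neither neighbourhood of the edge `ab` is
isolated, or such a vertex has neighbours in both neighbourhoods and closes a 5-cycle with them. -/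
theorem isolated_or_pentagon (hF : K4minus.Free H) (hD : H.IsDominating) {k : ℕ}
    (hk : ∀ a b c : V, {a, b, c} ∈ H.edges → (H.coneighbors a b).card = k) {x a b : V}
    (hab : H.link x a b = true) :
    (∀ w z, H.link x a w = false → H.link x b w = false → H.link x w z = false) ∨
    ∃ v : Fin 6 → V, (∀ i j, H.link x (v i) (v j) = H6.link 5 i j) ∧ v 5 = x := by
  rw [or_iff_not_imp_left]
  intro h
  push Not at h
  obtain ⟨w, z, haw, hbw, hwz⟩ := h
  rw [ne_eq, Bool.not_eq_false] at hwz
  have hba : H.link x b a = true := (link_comm _ _ _).trans hab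
  have hcov : ∀ u, H.link x w u = true → H.link x a u = true ∨ H.link x b u = true := by
    intro u hu
    by_contra! hn
    simp only [ne_eq, Bool.not_eq_true] at hn
    exact link_not_two_disjoint_edges hF hD hab hu haw hn.1 hbw hn.2
  -- If all neighbours of `w` were neighbours of `p`, the two neighbourhoods would agree by
  -- cardinality, although `q` is adjacent to `p` only.
  have hnot : ∀ p q, H.link x p q = true → H.link x q w = false →
      ∃ u, H.link x w u = true ∧ H.link x p u = false := by
    intro p q hpq hqw
    by_contra! hn
    have hsub : H.coneighbors x w ⊆ H.coneighbors x p := by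
      intro u hu
      rw [mem_coneighbors, ← link_eq_true] at hu ⊢
      simpa using hn u hu
    have heq := Finset.eq_of_subset_of_card_le hsub (by
      rw [hk _ _ _ (link_eq_true.1 hwz), hk _ _ _ (link_eq_true.1 hpq)])
    have : q ∈ H.coneighbors x w := by
      rw [heq, mem_coneighbors, ← link_eq_true]; exact hpq
    rw [mem_coneighbors, ← link_eq_true, link_comm, hqw] at this
    exact absurd this (by decide)
  obtain ⟨s, hws, hbs⟩ := hnot b a hba haw
  obtain ⟨t, hwt, hat⟩ := hnot a b hab hbw
  have has : H.link x a s = true := (hcov s hws).resolve_right (by simp [hbs])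
  have hbt : H.link x b t = true := (hcov t hwt).resolve_left (by simp [hat])
  have hst : H.link x s t = false :=
    link_triangle_free hF ((link_comm _ _ _).trans hws) ((link_comm _ _ _).trans hwt)
  refine ⟨![a, w, t, b, s, x], fun i j => ?_, rfl⟩
  have hsym := fun y z => link_comm (H := H) x y z
  have h₁ : H.link x w a = false := (hsym _ _).trans haw
  have h₂ : H.link x w b = false := (hsym _ _).trans hbw
  have h₃ : H.link x s b = false := (hsym _ _).trans hbs
  have h₄ : H.link x t a = false := (hsym _ _).trans hat
  have h₅ : H.link x t s = false := (hsym _ _).trans hst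
  have h₆ : H.link x s w = true := (hsym _ _).trans hws
  have h₇ : H.link x t w = true := (hsym _ _).trans hwt
  have h₈ : H.link x s a = true := (hsym _ _).trans has
  have h₉ : H.link x t b = true := (hsym _ _).trans hbt
  have hc := fun y => link_center (H := H) x y
  have hc' := fun y => (hsym y x).trans (hc y)
  have hs := fun y => link_self (H := H) x y
  rw [H6_link_eq]
  fin_cases i <;> fin_cases j <;>
    simp [hc, hc', hs, hab, hba, haw, hbw, h₁, h₂, hws, h₆, hwt, h₇, has, h₈, hbt, h₉, hst, h₅,
      hbs, h₃, hat, h₄]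

/-- In the case of equality the co-neighbourhoods of the pairs of an edge partition the
vertices into three parts of size `k`. -/
theorem isDominating_of_card (hF : K4minus.Free H) {k : ℕ} (hV : Fintype.card V = 3 * k)
    (hk : ∀ a b c : V, {a, b, c} ∈ H.edges → k ≤ (H.coneighbors a b).card) :
    H.IsDominating ∧ ∀ a b c : V, {a, b, c} ∈ H.edges → (H.coneighbors a b).card = k := by
  have key : ∀ a b c : V, {a, b, c} ∈ H.edges → (H.coneighbors a b).card = k ∧
      H.coneighbors a b ∪ H.coneighbors b c ∪ H.coneighbors a c = Finset.univ := by
    intro a b c h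
    have h₁ := hk a b c h
    have h₂ := hk b c a (triple_mem_rotate h)
    have h₃ := hk a c b (triple_mem_swap_right h)
    have h₄ := card_coneighbors_union hF h
    have h₅ := Finset.card_le_univ (H.coneighbors a b ∪ H.coneighbors b c ∪ H.coneighbors a c)
    exact ⟨by omega, Finset.eq_univ_of_card _ (by omega)⟩
  refine ⟨fun a b c v h => ?_, fun a b c h => (key a b c h).1⟩
  have := (key a b c h).2 ▸ Finset.mem_univ v
  simpa only [Finset.mem_union, mem_coneighbors, or_assoc] using this

/-- Equality in the upper bound forces one of the two constructions; the class sizes follow from the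
codegrees. -/
theorem exists_eq_blowup (hF : K4minus.Free H) {k : ℕ} (hV : Fintype.card V = 3 * k)
    (hne : H.edges.Nonempty) (hk : k ≤ H.minPosCodegree) :
    (∃ c : V → Fin 3, H = singleEdge.blowup c ∧ ∀ i, classSize c i = k) ∨
    ∃ c : V → Fin 6, H = H6.blowup c ∧ ∀ i, 2 * classSize c i = k := by
  obtain ⟨hD, hk⟩ := isDominating_of_card hF hV ((le_minPosCodegree_iff hne).1 hk)
  obtain ⟨e, he⟩ := hne
  obtain ⟨x, a, b, -, -, -, rfl⟩ := Finset.card_eq_three.mp (H.uniform e he)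
  have hab : H.link x a b = true := link_eq_true.2 he
  rcases isolated_or_pentagon hF hD hk hab with hiso | ⟨v, hv, hx⟩
  · left
    obtain ⟨c, rfl⟩ := exists_eq_blowup_singleEdge hF hD hk hab hiso
    refine ⟨c, rfl, ?_⟩
    have hsum := sum_classSize c
    have h₁ := hk _ _ _ he
    have h₂ := hk _ _ _ (triple_mem_rotate he)
    have h₃ := hk _ _ _ (triple_mem_swap_right he)
    rw [mem_blowup_edges] at he
    rw [card_coneighbors_blowup] at h₁ h₂ h₃
    have hcn : ∀ i j l : Fin 3, {i, j, l} ∈ singleEdge.edges →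
        singleEdge.coneighbors i j = {l} ∧ ∀ m, m = i ∨ m = j ∨ m = l := by decide
    rw [(hcn _ _ _ he).1, Finset.sum_singleton] at h₁
    rw [(hcn _ _ _ (triple_mem_rotate he)).1, Finset.sum_singleton] at h₂
    rw [(hcn _ _ _ (triple_mem_swap_right he)).1, Finset.sum_singleton] at h₃
    intro i
    rcases (hcn _ _ _ he).2 i with rfl | rfl | rfl <;> assumption
  · right
    obtain ⟨c, hHc, hc⟩ := exists_eq_blowup_H6 hF hD hv hx
    refine ⟨c, hHc, ?_⟩
    -- Each vertex of the 5-cycle has degree `k` in the link of `x`.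
    have hdeg : ∀ i j, H6.link 5 i j = true → ∑ l with H6.link 5 i l = true, classSize c l = k := by
      intro i j hij
      rw [sum_classSize_filter, ← hk x (v i) (v j) (link_eq_true.1 ((hv i j).trans hij))]
      congr 1
      ext y
      rw [mem_coneighbors, ← link_eq_true, link_comm, hc, link_comm]
      simp
    have hsum := sum_classSize c
    have h₀ := hdeg 0 3 (by decide)
    have h₁ := hdeg 1 2 (by decide)
    have h₂ := hdeg 2 1 (by decide)
    have h₃ := hdeg 3 0 (by decide)
    have h₄ := hdeg 4 0 (by decide)
    rw [show (Finset.univ.filter fun l => H6.link 5 0 l = true) = {3, 4} by decide,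
      Finset.sum_pair (by decide)] at h₀
    rw [show (Finset.univ.filter fun l => H6.link 5 1 l = true) = {2, 4} by decide,
      Finset.sum_pair (by decide)] at h₁
    rw [show (Finset.univ.filter fun l => H6.link 5 2 l = true) = {1, 3} by decide,
      Finset.sum_pair (by decide)] at h₂
    rw [show (Finset.univ.filter fun l => H6.link 5 3 l = true) = {0, 2} by decide,
      Finset.sum_pair (by decide)] at h₃
    rw [show (Finset.univ.filter fun l => H6.link 5 4 l = true) = {0, 1} by decide,
      Finset.sum_pair (by decide)] at h₄
    rw [Fin.sum_univ_six] at hsum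
    intro i
    fin_cases i <;> simp only [Fin.zero_eta, Fin.mk_one, Fin.reduceFinMk] <;> omega

end Structure

/-! ### The two constructions -/

theorem classSize_residueClass_le_add_one {n k : ℕ} [NeZero k] (i j : Fin k) :
    classSize (residueClass n k) i ≤ classSize (residueClass n k) j + 1 :=
  isBalanced_residueClass n k i j

theorem balancedTripartite_eq_blowup (n : ℕ) :
    balancedTripartite n = singleEdge.blowup (residueClass n 3) :=
  completePartite_eq_blowup _

theorem le_classSize_residueClass_three (n : ℕ) (i : Fin 3) :
    n / 3 ≤ classSize (residueClass n 3) i := by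
  have hs := sum_classSize (residueClass n 3)
  have hb := classSize_residueClass_le_add_one (n := n) (k := 3)
  rw [Fin.sum_univ_three, Fintype.card_fin] at hs
  have h₁ := hb 0 i
  have h₂ := hb 1 i
  have h₃ := hb 2 i
  fin_cases i <;> simp only [Fin.zero_eta, Fin.mk_one, Fin.reduceFinMk] at * <;> omega

theorem classSize_residueClass_three {n k : ℕ} (hn : n = 3 * k) (i : Fin 3) :
    classSize (residueClass n 3) i = k := by
  have hs := sum_classSize (residueClass n 3)
  have h := le_classSize_residueClass_three n
  rw [Fin.sum_univ_three, Fintype.card_fin] at hs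
  have h₁ := h 0
  have h₂ := h 1
  have h₃ := h 2
  fin_cases i <;> simp only [Fin.zero_eta, Fin.mk_one, Fin.reduceFinMk] <;> omega

theorem classSize_residueClass_six {n m : ℕ} (hn : n = 6 * m) (i : Fin 6) :
    classSize (residueClass n 6) i = m := by
  have hs := sum_classSize (residueClass n 6)
  have hb := classSize_residueClass_le_add_one (n := n) (k := 6)
  rw [Fin.sum_univ_six, Fintype.card_fin] at hs
  have h := fun j => And.intro (hb j i) (hb i j)
  have h₀ := h 0
  have h₁ := h 1
  have h₂ := h 2
  have h₃ := h 3
  have h₄ := h 4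
  have h₅ := h 5
  fin_cases i <;> simp only [Fin.zero_eta, Fin.mk_one, Fin.reduceFinMk] at * <;> omega

section Constructions

variable {V W : Type*} [Fintype V] [DecidableEq W]

theorem exists_of_classSize_pos {c : V → W} {i : W} (h : 0 < classSize c i) : ∃ v, c v = i := by
  obtain ⟨v, hv⟩ := Finset.card_pos.mp h
  exact ⟨v, (Finset.mem_filter.mp hv).2⟩

variable [DecidableEq V]

theorem blowup_edges_nonempty {G : ThreeGraph W} {c : V → W} {i j k : W}
    (h : {i, j, k} ∈ G.edges) (hc : ∀ l, 0 < classSize c l) : (G.blowup c).edges.Nonempty := by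
  obtain ⟨u, rfl⟩ := exists_of_classSize_pos (hc i)
  obtain ⟨v, rfl⟩ := exists_of_classSize_pos (hc j)
  obtain ⟨w, rfl⟩ := exists_of_classSize_pos (hc k)
  exact ⟨_, mem_blowup_edges.2 h⟩

theorem le_minPosCodegree_blowup_singleEdge {c : V → Fin 3} {k : ℕ}
    (hc : ∀ i, k ≤ classSize c i) : k ≤ (singleEdge.blowup c).minPosCodegree := by
  rcases Nat.eq_zero_or_pos k with rfl | hk
  · exact Nat.zero_le _
  rw [le_minPosCodegree_iff (blowup_edges_nonempty (i := 0) (j := 1) (k := 2) (by decide)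
    fun i => hk.trans_le (hc i))]
  intro u v w h
  rw [mem_blowup_edges] at h
  rw [card_coneighbors_blowup]
  exact (hc (c w)).trans (Finset.single_le_sum (f := classSize c) (fun _ _ => Nat.zero_le _)
    (mem_coneighbors.2 h))

theorem le_minPosCodegree_blowup_H6 {c : V → Fin 6} {m : ℕ}
    (hc : ∀ i, m ≤ classSize c i) : 2 * m ≤ (H6.blowup c).minPosCodegree := by
  rcases Nat.eq_zero_or_pos m with rfl | hm
  · exact Nat.zero_le _
  rw [le_minPosCodegree_iff (blowup_edges_nonempty (i := 0) (j := 1) (k := 2) (by decide)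
    fun i => hm.trans_le (hc i))]
  intro u v w h
  rw [mem_blowup_edges] at h
  rw [card_coneighbors_blowup, ← H6_coneighbors_card _ _ (ne_of_triple_mem h).1, ← smul_eq_mul]
  exact Finset.card_nsmul_le_sum _ _ _ fun i _ => hc i

/-- In `H₆` any two vertices lie in a common edge, whereas four vertices of a 3-partite 3-graph
contain two of the same class. -/
theorem blowup_singleEdge_ne_blowup_H6 (c : V → Fin 3) {c' : V → Fin 6}
    (hc' : ∀ i, 0 < classSize c' i) : singleEdge.blowup c ≠ H6.blowup c' := by
  intro h
  choose v hv using fun i => exists_of_classSize_pos (hc' i)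
  obtain ⟨i, j, hij, hcij⟩ := Fintype.exists_ne_map_eq_of_card_lt (fun i => c (v i)) (by simp)
  obtain ⟨k, hk⟩ : (H6.coneighbors i j).Nonempty := by
    rw [← Finset.card_pos, H6_coneighbors_card i j hij]
    exact Nat.two_pos
  rw [mem_coneighbors, ← hv i, ← hv j, ← hv k, ← mem_blowup_edges, ← h, mem_blowup_edges] at hk
  exact (ne_of_triple_mem hk).1 hcij

end Constructions

/-! ### Extremal 3-graphs -/

theorem coex_K4minus (n : ℕ) : coex n K4minus = n / 3 := by
  have hg := isGreatest_coex n K4minus ⟨{0, 1, 2}, by decide⟩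
  refine le_antisymm ?_ ?_
  · obtain ⟨H, hF, hH⟩ := hg.1
    rw [← hH]
    simpa using minPosCodegree_le hF
  · refine le_trans ?_ (hg.2 ⟨balancedTripartite n, ?_, rfl⟩)
    · rw [balancedTripartite_eq_blowup]
      exact le_minPosCodegree_blowup_singleEdge (le_classSize_residueClass_three n)
    · rw [balancedTripartite_eq_blowup]
      exact free_blowup singleEdge_free _

theorem isExtremal_iff {n : ℕ} {H : ThreeGraph (Fin n)} :
    K4minus.IsExtremal H ↔ K4minus.Free H ∧ n / 3 ≤ H.minPosCodegree := by
  rw [IsExtremal, coex_K4minus]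
  refine and_congr_right fun hF => ⟨fun h => h.ge, fun h => le_antisymm ?_ h⟩
  simpa using minPosCodegree_le hF

theorem isExtremal_of_isomorphic_balancedTripartite {n : ℕ} {H : ThreeGraph (Fin n)}
    (h : H.Isomorphic (balancedTripartite n)) : K4minus.IsExtremal H := by
  rw [balancedTripartite_eq_blowup, isomorphic_blowup_iff] at h
  obtain ⟨c, rfl, hc⟩ := h
  exact isExtremal_iff.2 ⟨free_blowup singleEdge_free _, le_minPosCodegree_blowup_singleEdge
    fun i => (hc i).symm ▸ le_classSize_residueClass_three n i⟩

theorem isExtremal_of_isomorphic_balancedBlowupH6 {n m : ℕ} (hn : n = 6 * m)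
    {H : ThreeGraph (Fin n)} (h : H.Isomorphic (balancedBlowupH6 n)) : K4minus.IsExtremal H := by
  rw [balancedBlowupH6, isomorphic_blowup_iff] at h
  obtain ⟨c, rfl, hc⟩ := h
  rw [isExtremal_iff, show n / 3 = 2 * m by omega]
  exact ⟨free_blowup H6_free _, le_minPosCodegree_blowup_H6
    fun i => ((hc i).trans (classSize_residueClass_six hn i)).ge⟩

theorem isomorphic_of_isExtremal {n k : ℕ} (hn : n = 3 * k) (hk : 0 < k) {H : ThreeGraph (Fin n)}
    (h : K4minus.IsExtremal H) : H.Isomorphic (balancedTripartite n) ∨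
      Even k ∧ H.Isomorphic (balancedBlowupH6 n) := by
  rw [isExtremal_iff, show n / 3 = k by omega] at h
  have hne : H.edges.Nonempty := by
    by_contra hne
    have := h.2
    rw [minPosCodegree, if_neg hne] at this
    omega
  rcases exists_eq_blowup h.1 (by simpa using hn) hne h.2 with ⟨c, rfl, hc⟩ | ⟨c, rfl, hc⟩
  · left
    rw [balancedTripartite_eq_blowup, isomorphic_blowup_iff]
    exact ⟨c, rfl, fun i => by rw [hc, classSize_residueClass_three hn]⟩
  · right
    have hm := hc 0
    refine ⟨⟨classSize c 0, by omega⟩, ?_⟩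
    rw [balancedBlowupH6, isomorphic_blowup_iff]
    refine ⟨c, rfl, fun i => ?_⟩
    have hi := hc i
    rw [classSize_residueClass_six (m := classSize c 0) (by omega)]
    omega

theorem not_isomorphic_balancedTripartite_balancedBlowupH6 {n m : ℕ} (hn : n = 6 * m)
    (hm : 0 < m) : ¬ (balancedTripartite n).Isomorphic (balancedBlowupH6 n) := by
  rw [balancedTripartite_eq_blowup, balancedBlowupH6, isomorphic_blowup_iff]
  rintro ⟨c, h, hc⟩
  refine blowup_singleEdge_ne_blowup_H6 _ (fun i => ?_) h
  rwa [hc, classSize_residueClass_six hn]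

end ThreeGraph

theorem mainTheorem3 :
    (∀ n : ℕ, ThreeGraph.coex n ThreeGraph.K4minus = n / 3) ∧
    (∀ n : ℕ, 0 < n → n % 6 = 0 →
      (∀ H : ThreeGraph (Fin n), ThreeGraph.K4minus.IsExtremal H ↔
        (H.Isomorphic (ThreeGraph.balancedTripartite n) ∨
          H.Isomorphic (ThreeGraph.balancedBlowupH6 n))) ∧
      ¬ (ThreeGraph.balancedTripartite n).Isomorphic (ThreeGraph.balancedBlowupH6 n)) ∧
    (∀ n : ℕ, n % 6 = 3 →
      ∀ H : ThreeGraph (Fin n), ThreeGraph.K4minus.IsExtremal H ↔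
        H.Isomorphic (ThreeGraph.balancedTripartite n)) := by
  refine ⟨ThreeGraph.coex_K4minus, fun n hn h6 => ?_, fun n h3 H => ?_⟩
  · obtain ⟨m, rfl⟩ := Nat.dvd_of_mod_eq_zero h6
    refine ⟨fun H => ⟨fun h => ?_, fun h => ?_⟩,
      ThreeGraph.not_isomorphic_balancedTripartite_balancedBlowupH6 rfl (by omega)⟩
    · exact (ThreeGraph.isomorphic_of_isExtremal (k := 2 * m) (by omega) (by omega) h).imp_right
        And.right
    · exact h.elim ThreeGraph.isExtremal_of_isomorphic_balancedTripartite
        (ThreeGraph.isExtremal_of_isomorphic_balancedBlowupH6 rfl)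
  · refine ⟨fun h => ?_, ThreeGraph.isExtremal_of_isomorphic_balancedTripartite⟩
    rcases ThreeGraph.isomorphic_of_isExtremal (k := n / 3) (by omega) (by omega) h with
      h | ⟨⟨r, hr⟩, -⟩
    · exact h
    · omega
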